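/- Let $(V,g)$ be a real vector space of finite dimension $n\ge 4$ with a Lorentzian inner product of signature $(-,+,\dots,+)$ (for instance the tangent space at a point of an $n$-dimensional spacetime), and let $C$ be a Weyl tensor on $V$: a covariant rank-4 tensor with $C_{(ab)cd}=C_{ab(cd)}=0$, $C_{abcd}=C_{cdab}$, $C_{a[bcd]}=0$ and $g^{ac}C_{abcd}=0$. For a unit timelike vector $u$ ($g(u,u)=-1$) let $\theta_u(x)=x+2g(u,x)u$ be the reflection with $u\mapsto -u$ that fixes $u^\perp$, let $\theta_u(C)(x,y,z,w)=C(\theta_u x,\theta_u y,\theta_u z,\theta_u w)$, and put $C_\pm=\tfrac12\,(C\pm\theta_u(C))$. Call $C$ *properly purely electric (PE)* with respect to $u$ if $C=C_+\neq0$, *properly purely magnetic (PM)* with respect to $u$ if $C=C_-\neq 0$, and properly PE (PM) if it is so with respect to some unit timelike $u$. A *null frame* is a basis $(m_0,m_1,m_3,\dots,m_n)=(\ell,\mathbf n,m_3,\dots,m_n)$ with $\ell,\mathbf n$ null, $g(\ell,\mathbf n)=1$, and $m_3,\dots,m_n$ orthonormal, spacelike and orthogonal to $\ell,\mathbf n$.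 The *boost weight* of a component $C_{\alpha\beta\gamma\delta}$ is the number of its indices $0$ minus the number of its indices $1$. For $C\ne0$ and a nonzero null vector $\ell$, the *boost order* $b(\ell)$ is the maximal boost weight of a nonvanishing component of $C$ in a null frame with $m_0=\ell$ (it does not depend on the frame). A null direction spanned by $\ell$ is a *WAND* if $b(\ell)\le 1$ and a *multiple WAND* if $b(\ell)\le 0$. Let $b_{\min}$ be the minimum of $b(\ell)$ over all null $\ell\neq 0$, let $\chi$ be the minimum of $b(\mathbf n)$ over all null $\mathbf n$ for which some null $\ell$ satisfies $b(\ell)=b_{\min}$ and $g(\ell,\mathbf n)=1$, and put $p=2-b_{\min}$, $s=2-\chi$. A nonzero $C$ is of *type G* if $p=0$ (it has no WANDs), of *type I$_i$* if $(p,s)=(1,1)$, and of *type D* if $(p,s)=(2,2)$. Let $\mathcal L\subseteq V$ be the subspace spanned by all multiple WANDs. **Proposition.** 1. $C$ is never both properly PE and properly PM, not even with respect to two different unit timelike vectors. 2. If $C$ is of type D and properly PE (respectively properly PM), then $\mathcal L$ is a Lorentzian subspace, and $C$ is properly PE (respectively properly PM) with respect to a unit timelike vector $u$ if and only if $u\in\mathcal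 L$. 3. If $C$ is of type I$_i$ or G and properly PE (respectively properly PM) with respect to $u$, then the unit timelike vectors with respect to which it is properly PE (respectively properly PM) are exactly $u$ and $-u$. -/

import Mathlib

noncomputable section

namespace NullAlign

open Module

variable {V : Type*} [AddCommGroup V] [Module ℝ V]

/-- A symmetric bilinear form of signature `(n - 1, 1)`, i.e. `(-, +, ..., +)`. -/
structure IsLorentzian (g : LinearMap.BilinForm ℝ V) : Prop where
  symm : ∀ x y, g x y = g y x
  sigNeg_eq : sigNeg g.toQuadraticMap = 1
  sigPos_eq : sigPos g.toQuadraticMap + 1 = finrank ℝ V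

/-- Covariant tensors of rank four; `C ![x, y, z, w]` is `C_{abcd} x^a y^b z^c w^d`. -/
abbrev Tensor4 (V : Type*) [AddCommGroup V] [Module ℝ V] : Type _ :=
  MultilinearMap ℝ (fun _ : Fin 4 => V) ℝ

/-- The algebraic symmetries of a Weyl tensor: the symmetries of a curvature tensor, and the
vanishing of the trace `g^{ac} C_{abcd}`. The trace is computed in an arbitrary basis `e` and
its `g`-dual basis `e'` (characterised by `g (e i) (e' j) = δ_{ij}`). -/
structure IsWeylTensor (g : LinearMap.BilinForm ℝ V) (C : Tensor4 V) : Prop where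
  antisymm_left : ∀ x y z w, C ![x, y, z, w] = -C ![y, x, z, w]
  antisymm_right : ∀ x y z w, C ![x, y, z, w] = -C ![x, y, w, z]
  pair_symm : ∀ x y z w, C ![x, y, z, w] = C ![z, w, x, y]
  bianchi : ∀ x y z w, C ![x, y, z, w] + C ![x, z, w, y] + C ![x, w, y, z] = 0
  trace_free : ∀ (ι : Type) [Fintype ι] [DecidableEq ι] (e e' : Basis ι ℝ V),
    (∀ i j, g (e i) (e' j) = if i = j then 1 else 0) →
    ∀ x y, ∑ i, C ![e i, x, e' i, y] = 0

/-! ### Electric and magnetic parts -/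

/-- Unit timelike vectors. -/
def IsUnitTimelike (g : LinearMap.BilinForm ℝ V) (u : V) : Prop := g u u = -1

/-- The time reflection `x ↦ x + 2 g(u, x) u`; for a unit timelike `u` it sends `u` to `-u` and
fixes the orthogonal complement of `u` (the Cartan involution associated with `u`). -/
def timeReflection (g : LinearMap.BilinForm ℝ V) (u : V) : V →ₗ[ℝ] V :=
  LinearMap.id + (2 : ℝ) • (g u).smulRight u

/-- The action of the time reflection, which is its own inverse, on tensors. -/
def reflectTensor (g : LinearMap.BilinForm ℝ V) (u : V) (C : Tensor4 V) : Tensor4 V :=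
  C.compLinearMap fun _ => timeReflection g u

/-- The electric part `C₊` of `C` with respect to `u`. -/
def electricPart (g : LinearMap.BilinForm ℝ V) (u : V) (C : Tensor4 V) : Tensor4 V :=
  (1 / 2 : ℝ) • (C + reflectTensor g u C)

/-- The magnetic part `C₋` of `C` with respect to `u`. -/
def magneticPart (g : LinearMap.BilinForm ℝ V) (u : V) (C : Tensor4 V) : Tensor4 V :=
  (1 / 2 : ℝ) • (C - reflectTensor g u C)

/-- `C` is properly purely electric with respect to `u`: `C = C₊ ≠ 0`. -/
def IsProperlyPE (g : LinearMap.BilinForm ℝ V) (C : Tensor4 V) (u : V) : Prop :=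
  C = electricPart g u C ∧ electricPart g u C ≠ 0

/-- `C` is properly purely magnetic with respect to `u`: `C = C₋ ≠ 0`. -/
def IsProperlyPM (g : LinearMap.BilinForm ℝ V) (C : Tensor4 V) (u : V) : Prop :=
  C = magneticPart g u C ∧ magneticPart g u C ≠ 0

/-! ### Null alignment -/

/-- Null vectors (nonzero by convention). -/
def IsNull (g : LinearMap.BilinForm ℝ V) (l : V) : Prop := l ≠ 0 ∧ g l l = 0

/-- Null frames `(m₀ = l, m₁ = n, m_i)` of an `n`-dimensional Lorentzian space, with `l`, `n` null,
`g(l, n) = 1` and `n - 2` orthonormal spacelike vectors `m_i` orthogonal to `l` and `n`. -/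
structure NullFrame (g : LinearMap.BilinForm ℝ V) where
  /-- The first null vector `m₀`. -/
  l : V
  /-- The second null vector `m₁`. -/
  n : V
  /-- The spacelike vectors of the frame. -/
  m : Fin (finrank ℝ V - 2) → V
  l_null : g l l = 0
  n_null : g n n = 0
  l_n : g l n = 1
  l_m : ∀ i, g l (m i) = 0
  n_m : ∀ i, g n (m i) = 0
  m_m : ∀ i j, g (m i) (m j) = if i = j then 1 else 0

/-- Frame labels: the two null labels `0`, `1`, and the spacelike labels. -/
abbrev FrameLabel (V : Type*) [AddCommGroup V] [Module ℝ V] : Type :=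
  Fin 2 ⊕ Fin (finrank ℝ V - 2)

/-- The frame vector with a given label. -/
def NullFrame.vec {g : LinearMap.BilinForm ℝ V} (F : NullFrame g) : FrameLabel V → V :=
  Sum.elim ![F.l, F.n] F.m

/-- The component `C_{α₀ α₁ α₂ α₃}` of `C` in a null frame. -/
def NullFrame.component {g : LinearMap.BilinForm ℝ V} (F : NullFrame g) (C : Tensor4 V)
    (α : Fin 4 → FrameLabel V) : ℝ :=
  C fun k => F.vec (α k)

/-- The boost weight of a tuple of labels: the number of labels `0` minus the number of
labels `1`. -/
def boostWeight (α : Fin 4 → FrameLabel V) : ℤ :=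
  ∑ k, Sum.elim (![1, -1] : Fin 2 → ℤ) (fun _ => 0) (α k)

/-- The boost order of `C ≠ 0` along a null vector `l`: the maximal boost weight of a
nonvanishing component of `C` in a null frame with `m₀ = l` (the maximum is the same
for all such frames). -/
def boostOrder (g : LinearMap.BilinForm ℝ V) (C : Tensor4 V) (l : V) : ℤ :=
  sSup {b : ℤ | ∃ F : NullFrame g, F.l = l ∧ ∃ α, F.component C α ≠ 0 ∧ boostWeight α = b}

/-- The maximal boost order of tensors with the symmetries of a Weyl tensor. -/
def bMax : ℤ := 2

/-- The alignment order of a null vector; the aligned null directions (WANDs) are the null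
directions of positive alignment order. -/
def alignmentOrder (g : LinearMap.BilinForm ℝ V) (C : Tensor4 V) (l : V) : ℤ :=
  bMax - boostOrder g C l

/-- `l` spans a multiple WAND: an aligned null direction of alignment order at least two. -/
def IsMultipleWAND (g : LinearMap.BilinForm ℝ V) (C : Tensor4 V) (l : V) : Prop :=
  IsNull g l ∧ 2 ≤ alignmentOrder g C l

/-- The minimal boost order over all null vectors. -/
def bMin (g : LinearMap.BilinForm ℝ V) (C : Tensor4 V) : ℤ :=
  sInf {b : ℤ | ∃ l, IsNull g l ∧ boostOrder g C l = b}

/-- The primary alignment type. -/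
def primaryType (g : LinearMap.BilinForm ℝ V) (C : Tensor4 V) : ℤ := bMax - bMin g C

/-- The minimal boost order along null vectors `n` with `g(l, n) = 1` for some maximally
aligned null vector `l`. -/
def chiMin (g : LinearMap.BilinForm ℝ V) (C : Tensor4 V) : ℤ :=
  sInf {b : ℤ | ∃ l n, IsNull g l ∧ boostOrder g C l = bMin g C ∧ IsNull g n ∧ g l n = 1 ∧
    boostOrder g C n = b}

/-- The secondary alignment type. -/
def secondaryType (g : LinearMap.BilinForm ℝ V) (C : Tensor4 V) : ℤ := bMax - chiMin g C

/-- Type G: nonzero, without aligned null directions. -/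
def IsTypeG (g : LinearMap.BilinForm ℝ V) (C : Tensor4 V) : Prop := C ≠ 0 ∧ primaryType g C = 0

/-- Type I_i: nonzero, of alignment type `(1, 1)`. -/
def IsTypeIi (g : LinearMap.BilinForm ℝ V) (C : Tensor4 V) : Prop :=
  C ≠ 0 ∧ primaryType g C = 1 ∧ secondaryType g C = 1

/-- Type D: nonzero, of alignment type `(2, 2)`. -/
def IsTypeD (g : LinearMap.BilinForm ℝ V) (C : Tensor4 V) : Prop :=
  C ≠ 0 ∧ primaryType g C = 2 ∧ secondaryType g C = 2

/-- The subspace spanned by all multiple WANDs. -/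
def multipleWANDSpan (g : LinearMap.BilinForm ℝ V) (C : Tensor4 V) : Submodule ℝ V :=
  Submodule.span ℝ {l | IsMultipleWAND g C l}

end NullAlign

end

noncomputable section

namespace NullAlign

open Module

variable {V : Type*} [AddCommGroup V] [Module ℝ V] {g : LinearMap.BilinForm ℝ V}

/-! ### Lorentzian forms -/

/-! Write `u = p l + q n` in a null frame. Reflection in `u` swaps the two null directions up to
scale, so it turns a component of boost weight `b` into `(2q²)^b` times the component with the
labels 0 and 1 exchanged (`component_reflectTensor`). PE and PM are the cases `ε = 1` and `ε = -1`
of `θ_u C = ε C`.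

If `C` has definite parity for both `u` and `u' ≠ ±u`, take a null frame whose null plane contains
both. The two scale factors differ, so only boost weight 0 survives
(`component_eq_zero_of_reflectTensor`). There both reflections act alike, so the parities agree;
moreover `l` is a multiple WAND, which types I_i and G exclude.

For type D, parity carries a multiple WAND to its reflected direction, and `u` lies in the span of
the two. Conversely, for each multiple WAND `l` the boost generator `u ∧ l` annihilates `C`. This
condition is linear in `l`, so `u ∧ u'` annihilates `C` for every `u'` in the span. If `u' ≠ ±u`,
that generator acts on components as a nonzero multiple of the boost weight, so again only weight 0
remains and `θ_{u'} C = θ_u C`. -/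

/-- Otherwise `u` and `x` would span a plane on which the form is nonpositive, leaving room for at
most `n - 2` positive directions. -/
theorem IsLorentzian.pos_of_orthogonal [FiniteDimensional ℝ V] (hg : IsLorentzian g) {u x : V}
    (hu : IsUnitTimelike g u) (hux : g u x = 0) (hx : x ≠ 0) : 0 < g x x := by
  by_contra! hle
  have hu' : g u u = -1 := hu
  have hxu : g x u = 0 := by rw [hg.symm, hux]
  have hli : LinearIndependent ℝ ![u, x] := by
    rw [LinearIndependent.pair_iff]
    intro s t h
    have h1 := congrArg (g u) h
    simp only [map_add, map_smul, hu', hux, smul_eq_mul, map_zero] at h1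
    have hs : s = 0 := by linarith
    subst hs
    simpa [hx] using h
  have hfin : finrank ℝ (Submodule.span ℝ (Set.range ![u, x])) = 2 := by
    simpa using finrank_span_eq_card hli
  have hV : ∀ y ∈ Submodule.span ℝ (Set.range ![u, x]), g.toQuadraticMap y ≤ 0 := by
    intro y hy
    rw [Matrix.range_cons, Matrix.range_cons, Matrix.range_empty, Set.union_empty,
      Set.singleton_union, Submodule.mem_span_pair] at hy
    obtain ⟨a, b, rfl⟩ := hy
    simp only [LinearMap.BilinMap.toQuadraticMap_apply, map_add, map_smul, LinearMap.add_apply,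
      LinearMap.smul_apply, hu', hux, hxu, smul_eq_mul]
    nlinarith [sq_nonneg a, mul_nonneg (sq_nonneg b) (neg_nonneg.2 hle)]
  have := QuadraticForm.sigPos_add_finrank_le_of_nonpos hV
  have := hg.sigPos_eq
  omega

theorem IsUnitTimelike.apply_ne_zero [FiniteDimensional ℝ V] (hg : IsLorentzian g) {u l : V}
    (hu : IsUnitTimelike g u) (hl : IsNull g l) : g u l ≠ 0 := fun h =>
  (hg.pos_of_orthogonal hu h hl.1).ne' hl.2

theorem IsLorentzian.nondegenerate [FiniteDimensional ℝ V] (hg : IsLorentzian g) {u : V}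
    (hu : IsUnitTimelike g u) : g.Nondegenerate := by
  have hu' : g u u = -1 := hu
  have key : ∀ x, (∀ y, g x y = 0) → x = 0 := by
    intro x hx
    by_contra hne
    exact (hg.pos_of_orthogonal hu (by rw [hg.symm, hx]) hne).ne' (hx x)
  exact ⟨fun x hx => key x hx, fun x hx => key x fun y => by rw [hg.symm]; exact hx y⟩

/-- The line of `u` is negative definite and its orthogonal complement in `L` is positive definite
of codimension at most one; counting dimensions fixes the signature. -/
theorem IsLorentzian.restrict [FiniteDimensional ℝ V] (hg : IsLorentzian g) {u : V}
    (hu : IsUnitTimelike g u) {L : Submodule ℝ V} (huL : u ∈ L) :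
    IsLorentzian (g.restrict L) := by
  have hu' : g u u = -1 := hu
  have hne : u ≠ 0 := by
    rintro rfl
    simp at hu'
  have hpos : ((g.restrict L).toQuadraticMap.restrict
      (LinearMap.ker ((g u).comp L.subtype))).PosDef := by
    rintro ⟨x, hx⟩ hx0
    have hx' : g u (x : V) = 0 := hx
    exact hg.pos_of_orthogonal hu hx' (by simpa using hx0)
  have hneg : ((-(g.restrict L).toQuadraticMap).restrict
      (Submodule.span ℝ {(⟨u, huL⟩ : L)})).PosDef := by
    rintro ⟨x, hx⟩ hx0
    obtain ⟨a, rfl⟩ := Submodule.mem_span_singleton.1 hx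
    have ha : a ≠ 0 := by
      rintro rfl
      simp at hx0
    have : 0 < a * a := mul_self_pos.2 ha
    simpa [QuadraticMap.restrict_apply, hu'] using this
  have h1 := le_sigPos_of_posDef _ hpos
  have h2 := le_sigNeg_of_negDef _ hneg
  have h3 := QuadraticForm.sigPos_add_sigNeg_add_radical (Q := (g.restrict L).toQuadraticMap)
  have h4 := LinearMap.finrank_range_add_finrank_ker ((g u).comp L.subtype)
  have h5 : finrank ℝ (LinearMap.range ((g u).comp L.subtype)) ≤ 1 := by
    simpa using Submodule.finrank_le (LinearMap.range ((g u).comp L.subtype))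
  rw [finrank_span_singleton (by simpa using hne)] at h2
  exact ⟨fun x y => hg.symm x y, by omega, by omega⟩

theorem IsLorentzian.exists_unit_orthogonal [FiniteDimensional ℝ V] (hg : IsLorentzian g)
    (hn : 2 ≤ finrank ℝ V) {u : V} (hu : IsUnitTimelike g u) : ∃ e, g u e = 0 ∧ g e e = 1 := by
  have h4 := LinearMap.finrank_range_add_finrank_ker (g u)
  have h5 : finrank ℝ (LinearMap.range (g u)) ≤ 1 := by
    simpa using Submodule.finrank_le (LinearMap.range (g u))
  have : Nontrivial (LinearMap.ker (g u)) := finrank_pos_iff (R := ℝ).1 (by omega)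
  obtain ⟨⟨x, hx⟩, hx0⟩ := exists_ne (0 : LinearMap.ker (g u))
  have hx' : g u x = 0 := hx
  have hpos := hg.pos_of_orthogonal hu hx' (by simpa using hx0)
  refine ⟨(√(g x x))⁻¹ • x, by simp [hx'], ?_⟩
  have := Real.mul_self_sqrt hpos.le
  have := (Real.sqrt_pos.2 hpos).ne'
  simp only [map_smul, LinearMap.smul_apply, smul_eq_mul]
  field_simp
  nlinarith

theorem IsLorentzian.isNull_add [FiniteDimensional ℝ V] (hg : IsLorentzian g) {u e : V}
    (hu : IsUnitTimelike g u) (hue : g u e = 0) (he : g e e = 1) : IsNull g (u + e) := by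
  have hu' : g u u = -1 := hu
  have heu : g e u = 0 := by rw [hg.symm, hue]
  refine ⟨fun h => ?_, by simp [hu', hue, heu, he]⟩
  have := congrArg (g u) h
  simp [hu', hue] at this

theorem IsLorentzian.exists_isNull [FiniteDimensional ℝ V] (hg : IsLorentzian g)
    (hn : 2 ≤ finrank ℝ V) {u : V} (hu : IsUnitTimelike g u) : ∃ l, IsNull g l := by
  obtain ⟨e, hue, he⟩ := hg.exists_unit_orthogonal hn hu
  exact ⟨_, hg.isNull_add hu hue he⟩

/-! ### Null frames -/

/-- The boost weight of a single frame label. -/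
def labelWeight (a : FrameLabel V) : ℤ := Sum.elim (![1, -1] : Fin 2 → ℤ) (fun _ => 0) a

/-- The exchange of the two null labels. -/
def swapLabel (a : FrameLabel V) : FrameLabel V :=
  Sum.elim ![Sum.inl 1, Sum.inl 0] Sum.inr a

theorem boostWeight_eq (α : Fin 4 → FrameLabel V) : boostWeight α = ∑ k, labelWeight (α k) := rfl

@[simp] theorem swapLabel_swapLabel (a : FrameLabel V) : swapLabel (swapLabel a) = a := by
  rcases a with a | a
  · fin_cases a <;> rfl
  · rfl

@[simp] theorem labelWeight_swapLabel (a : FrameLabel V) :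
    labelWeight (swapLabel a) = -labelWeight a := by
  rcases a with a | a
  · fin_cases a <;> rfl
  · rfl

theorem boostWeight_swapLabel (α : Fin 4 → FrameLabel V) :
    boostWeight (fun k => swapLabel (α k)) = -boostWeight α := by
  simp [boostWeight_eq]

theorem labelWeight_le (a : FrameLabel V) : labelWeight a ≤ 1 := by
  rcases a with a | a
  · fin_cases a <;> simp [labelWeight]
  · simp [labelWeight]

theorem boostWeight_le (α : Fin 4 → FrameLabel V) : boostWeight α ≤ 4 := by
  rw [boostWeight_eq]
  simpa using Finset.sum_le_sum fun k (_ : k ∈ Finset.univ) => labelWeight_le (α k)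

theorem neg_four_le_boostWeight (α : Fin 4 → FrameLabel V) : -4 ≤ boostWeight α := by
  have := boostWeight_le fun k => swapLabel (α k)
  rw [boostWeight_swapLabel] at this
  omega

namespace NullFrame

@[simp] theorem vec_inl_zero (F : NullFrame g) : F.vec (Sum.inl 0) = F.l := rfl
@[simp] theorem vec_inl_one (F : NullFrame g) : F.vec (Sum.inl 1) = F.n := rfl
@[simp] theorem vec_inr (F : NullFrame g) (i) : F.vec (Sum.inr i) = F.m i := rfl

theorem isNull_l (F : NullFrame g) : IsNull g F.l :=
  ⟨fun h => by simpa [h] using F.l_n, F.l_null⟩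

/-- The null frame with the two null vectors exchanged. -/
def swap (hg : IsLorentzian g) (F : NullFrame g) : NullFrame g where
  l := F.n
  n := F.l
  m := F.m
  l_null := F.n_null
  n_null := F.l_null
  l_n := by rw [hg.symm, F.l_n]
  l_m := F.n_m
  n_m := F.l_m
  m_m := F.m_m

theorem swap_vec (hg : IsLorentzian g) (F : NullFrame g) (a : FrameLabel V) :
    (F.swap hg).vec a = F.vec (swapLabel a) := by
  rcases a with a | a
  · fin_cases a <;> rfl
  · rfl

/-- The dual basis of a null frame is the same frame with the null labels exchanged; this yields
independence and the coordinate formula. -/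
theorem apply_vec_swapLabel (hg : IsLorentzian g) (F : NullFrame g) (a b : FrameLabel V) :
    g (F.vec (swapLabel a)) (F.vec b) = if a = b then 1 else 0 := by
  have hnl : g F.n F.l = 1 := by rw [hg.symm, F.l_n]
  have hml : ∀ i, g (F.m i) F.l = 0 := fun i => by rw [hg.symm, F.l_m]
  have hmn : ∀ i, g (F.m i) F.n = 0 := fun i => by rw [hg.symm, F.n_m]
  rcases a with a | a <;> rcases b with b | b
  · fin_cases a <;> fin_cases b <;> simp [swapLabel, F.l_null, F.n_null, F.l_n, hnl]
  · fin_cases a <;> simp [swapLabel, F.l_m, F.n_m]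
  · fin_cases b <;> simp [swapLabel, hml, hmn]
  · simp [swapLabel, F.m_m]

theorem linearIndependent_vec (hg : IsLorentzian g) (F : NullFrame g) :
    LinearIndependent ℝ F.vec := by
  rw [Fintype.linearIndependent_iff]
  intro c hc a
  have := congrArg (g (F.vec (swapLabel a))) hc
  simpa [map_sum, F.apply_vec_swapLabel hg, -Fintype.sum_sum_type] using this

/-- A null frame as a basis. -/
def basis (hg : IsLorentzian g) (hn : 2 ≤ finrank ℝ V) (F : NullFrame g) :
    Basis (FrameLabel V) ℝ V :=
  haveI : Nonempty (FrameLabel V) := ⟨Sum.inl 0⟩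
  basisOfLinearIndependentOfCardEqFinrank (F.linearIndependent_vec hg) (by simp; omega)

@[simp] theorem basis_apply (hg : IsLorentzian g) (hn : 2 ≤ finrank ℝ V) (F : NullFrame g)
    (a : FrameLabel V) : F.basis hg hn a = F.vec a := by
  simp [basis]

theorem sum_apply_smul_vec (hg : IsLorentzian g) (hn : 2 ≤ finrank ℝ V) (F : NullFrame g)
    (x : V) : ∑ a, g (F.vec (swapLabel a)) x • F.vec a = x := by
  have h := (F.basis hg hn).sum_repr x
  simp only [basis_apply] at h
  have h2 : ∀ a, g (F.vec (swapLabel a)) x = (F.basis hg hn).repr x a := by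
    intro a
    conv_lhs => rw [← h]
    simp [map_sum, F.apply_vec_swapLabel hg, -Fintype.sum_sum_type]
  simp only [h2, h]

theorem ext_component (hg : IsLorentzian g) (hn : 2 ≤ finrank ℝ V) (F : NullFrame g)
    {C D : Tensor4 V} (h : ∀ α, F.component C α = F.component D α) : C = D := by
  refine Basis.ext_multilinear (fun _ => F.basis hg hn) fun α => ?_
  simpa [component] using h α

/-- A change of frame fixing `l` is triangular for the boost weight: each new vector involves only
old vectors of at least its own weight. Hence a bound on the boost order can be checked in a single
frame. -/
theorem component_eq_zero_of_l_eq (hg : IsLorentzian g) (hn : 2 ≤ finrank ℝ V)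
    {F F' : NullFrame g} (hl : F.l = F'.l) {C : Tensor4 V} {b : ℤ}
    (h : ∀ α, b < boostWeight α → F.component C α = 0) (β : Fin 4 → FrameLabel V)
    (hβ : b < boostWeight β) : F'.component C β = 0 := by
  have key : ∀ a c : FrameLabel V, labelWeight a < labelWeight c →
      g (F.vec (swapLabel a)) (F'.vec c) = 0 := by
    intro a c hac
    rcases a with a | a <;> rcases c with c | c
    · fin_cases a <;> fin_cases c <;> simp [labelWeight] at hac
      simp [swapLabel, ← hl, F.l_null]
    · fin_cases a <;> simp [labelWeight] at hac
      simp [swapLabel, hl, F'.l_m]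
    · fin_cases c <;> simp [labelWeight] at hac
      simp [swapLabel, ← hl, hg.symm (F.m a), F.l_m]
    · simp [labelWeight] at hac
  have hexp : (fun k => F'.vec (β k)) =
      fun k => ∑ a, g (F.vec (swapLabel a)) (F'.vec (β k)) • F.vec a :=
    funext fun k => (F.sum_apply_smul_vec hg hn _).symm
  rw [component, hexp, MultilinearMap.map_sum]
  refine Finset.sum_eq_zero fun α _ => ?_
  rw [MultilinearMap.map_smul_univ]
  by_cases hw : ∀ k, labelWeight (β k) ≤ labelWeight (α k)
  · have : boostWeight β ≤ boostWeight α := Finset.sum_le_sum fun k _ => hw k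
    have h0 : C (fun k => F.vec (α k)) = 0 := h α (by omega)
    rw [h0, smul_zero]
  · push Not at hw
    obtain ⟨k, hk⟩ := hw
    rw [Finset.prod_eq_zero (Finset.mem_univ k) (key _ _ hk), zero_smul]

end NullFrame

/-- For a unit timelike `u` and a null `l` there is a null frame whose null vectors are `l` and a
multiple of the reflection of `l`. -/
theorem IsLorentzian.exists_nullFrame [FiniteDimensional ℝ V] (hg : IsLorentzian g)
    {u l : V} (hu : IsUnitTimelike g u) (hl : IsNull g l) :
    ∃ F : NullFrame g, F.l = l ∧ ∃ p q : ℝ, u = p • F.l + q • F.n := by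
  have hu' : g u u = -1 := hu
  have hne := hu.apply_ne_zero hg hl
  have hll := hl.2
  have hlu := hg.symm l u
  set c := g u l with hc
  -- This is the reflection `l + 2c u` of `l`, divided by `2c²` so that `g l n = 1`.
  set n : V := (c)⁻¹ • u + (2 * c ^ 2)⁻¹ • l with hndef
  have hnn : g n n = 0 := by
    simp only [hndef, map_add, map_smul, LinearMap.add_apply, LinearMap.smul_apply, smul_eq_mul,
      hu', hll, hlu, ← hc]
    field_simp
    ring
  have hln : g l n = 1 := by
    simp only [hndef, map_add, map_smul, smul_eq_mul, hll, hlu]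
    field_simp
    ring
  have hli : LinearIndependent ℝ ![u, l] := by
    rw [LinearIndependent.pair_iff]
    intro s t h
    have h1 := congrArg (g l) h
    simp only [map_add, map_smul, hlu, hll, smul_eq_mul, map_zero, mul_zero, add_zero,
      mul_eq_zero, hne, or_false] at h1
    subst h1
    simpa [hl.1] using h
  set P := Submodule.span ℝ (Set.range ![u, l]) with hP
  have hfinP : finrank ℝ P = 2 := by
    simpa using finrank_span_eq_card hli
  have hfin : finrank ℝ (g.orthogonal P) = finrank ℝ V - 2 := by
    rw [LinearMap.BilinForm.finrank_orthogonal (hg.nondegenerate hu), hfinP]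
  have hW : ∀ x ∈ g.orthogonal P, g u x = 0 ∧ g l x = 0 := fun x hx =>
    ⟨hx u (Submodule.subset_span ⟨0, rfl⟩), hx l (Submodule.subset_span ⟨1, rfl⟩)⟩
  have hsymm : LinearMap.IsSymm (g.restrict (g.orthogonal P)) := ⟨fun x y => hg.symm x y⟩
  -- The complement of the plane is orthogonal to `u`, hence positive definite, so normalising an
  -- orthogonal basis of it gives the spacelike vectors.
  obtain ⟨v, hv⟩ := LinearMap.BilinForm.exists_orthogonal_basis (B := g.restrict (g.orthogonal P)) hsymm
  have hvpos : ∀ i, 0 < g (v i : V) (v i) := fun i =>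
    hg.pos_of_orthogonal hu (hW _ (v i).2).1 (by simpa using v.ne_zero i)
  let m : Fin (finrank ℝ V - 2) → V := fun i =>
    (√(g (v (Fin.cast hfin.symm i) : V) (v (Fin.cast hfin.symm i))))⁻¹ •
      (v (Fin.cast hfin.symm i) : V)
  have hum : ∀ i, g u (m i) = 0 := fun i => by simp [m, (hW _ (v (Fin.cast hfin.symm i)).2).1]
  have hlm : ∀ i, g l (m i) = 0 := fun i => by simp [m, (hW _ (v (Fin.cast hfin.symm i)).2).2]
  refine ⟨⟨l, n, m, hll, hnn, hln, hlm, fun i => by simp [hndef, hum, hlm], fun i j => ?_⟩, rfl,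
    -(2 * c)⁻¹, c, ?_⟩
  · split_ifs with hij
    · subst hij
      have hpos := hvpos (Fin.cast hfin.symm i)
      have := Real.mul_self_sqrt hpos.le
      have := (Real.sqrt_pos.2 hpos).ne'
      simp only [m, map_smul, LinearMap.smul_apply, smul_eq_mul]
      field_simp
      nlinarith
    · have h0 : g (v (Fin.cast hfin.symm i) : V) (v (Fin.cast hfin.symm j)) = 0 :=
        hv (by simpa using hij)
      simp [m, h0]
  · simp only [hndef, smul_add, smul_smul]
    rw [mul_inv_cancel₀ hne, one_smul, add_left_comm, ← add_smul]
    have : -(2 * c)⁻¹ + c * (2 * c ^ 2)⁻¹ = 0 := by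
      field_simp
      ring
    rw [this, zero_smul, add_zero]

/-- Two unit timelike vectors lie in the span of the null vectors of some null frame. -/
theorem IsLorentzian.exists_nullFrame_pair [FiniteDimensional ℝ V] (hg : IsLorentzian g)
    {u u' : V} (hu : IsUnitTimelike g u) (hu' : IsUnitTimelike g u') (hne : u' ≠ u)
    (hne' : u' ≠ -u) :
    ∃ F : NullFrame g, (∃ p q : ℝ, u = p • F.l + q • F.n) ∧ ∃ p q : ℝ, u' = p • F.l + q • F.n := by
  have hu1 : g u u = -1 := hu
  have hu2 : g u' u' = -1 := hu'
  have hs := hg.symm u' u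
  set c := g u u' with hc
  -- The part of `u'` orthogonal to `u`; the sign is plus because `g u u = -1`.
  set x := u' + c • u with hx
  have hux : g u x = 0 := by simp [hx, hu1, ← hc]
  have hx0 : x ≠ 0 := by
    intro h0
    have h1 : u' = -(c • u) := eq_neg_of_add_eq_zero_left h0
    have h2 : c * c = 1 := by
      rw [h1] at hu2
      simp only [map_neg, map_smul, LinearMap.neg_apply, LinearMap.smul_apply, smul_eq_mul, hu1]
        at hu2
      linarith
    rcases mul_self_eq_one_iff.1 h2 with h | h
    · exact hne' (by rw [h1, h, one_smul])
    · exact hne (by rw [h1, h]; simp)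
  have hpos := hg.pos_of_orthogonal hu hux hx0
  set d := √(g x x) with hd
  have hd0 : d ≠ 0 := (Real.sqrt_pos.2 hpos).ne'
  have hdd : d * d = g x x := Real.mul_self_sqrt hpos.le
  have he : g (d⁻¹ • x) (d⁻¹ • x) = 1 := by
    simp only [map_smul, LinearMap.smul_apply, smul_eq_mul, ← hdd]
    field_simp
  -- The null vector `u + x/|x|` lies in the plane of `u` and `u'`, so the frame it generates
  -- contains both.
  obtain ⟨F, hF, p, q, hpq⟩ := hg.exists_nullFrame hu (hg.isNull_add hu (by simp [hux]) he)
  refine ⟨F, ⟨p, q, hpq⟩, d - (d + c) * p, -(d + c) * q, ?_⟩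
  have h1 : u' = d • F.l - (d + c) • u := by
    rw [hF, smul_add, smul_smul, mul_inv_cancel₀ hd0, one_smul, hx]
    module
  conv_lhs => rw [h1, hpq]
  module

/-! ### Boost order -/

theorem NullFrame.component_eq_zero_of_boostOrder_le {F : NullFrame g} {C : Tensor4 V} {b : ℤ}
    (h : boostOrder g C F.l ≤ b) (α : Fin 4 → FrameLabel V) (hα : b < boostWeight α) :
    F.component C α = 0 := by
  by_contra hne
  refine absurd (show boostWeight α ≤ boostOrder g C F.l from le_csSup ⟨4, ?_⟩ ⟨F, rfl, α, hne, rfl⟩)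
    (not_le.2 (h.trans_lt hα))
  rintro _ ⟨_, _, β, _, rfl⟩
  exact boostWeight_le β

theorem NullFrame.boostOrder_l_nonpos (hg : IsLorentzian g) (hn : 2 ≤ finrank ℝ V)
    (F : NullFrame g) {C : Tensor4 V} (h : ∀ α, 0 < boostWeight α → F.component C α = 0) :
    boostOrder g C F.l ≤ 0 := by
  rw [boostOrder]
  rcases Set.eq_empty_or_nonempty {b : ℤ | ∃ F' : NullFrame g, F'.l = F.l ∧
      ∃ α, F'.component C α ≠ 0 ∧ boostWeight α = b} with he | he
  -- For `C = 0` the set is empty and the supremum takes the default value 0, which still satisfies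
  -- the bound.
  · rw [he, Int.csSup_empty]
  · refine csSup_le he ?_
    rintro _ ⟨F', hF', α, hα, rfl⟩
    by_contra! hlt
    exact hα (NullFrame.component_eq_zero_of_l_eq hg hn hF'.symm h α hlt)

/-- A crude bound, enough to make the infimum defining `bMin` attained. -/
theorem neg_four_le_boostOrder (g : LinearMap.BilinForm ℝ V) (C : Tensor4 V) (l : V) :
    -4 ≤ boostOrder g C l := by
  rw [boostOrder]
  rcases Set.eq_empty_or_nonempty {b : ℤ | ∃ F' : NullFrame g, F'.l = l ∧
      ∃ α, F'.component C α ≠ 0 ∧ boostWeight α = b} with he | ⟨b, hb⟩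
  · rw [he, Int.csSup_empty]; decide
  · refine le_trans ?_ (le_csSup ⟨4, ?_⟩ hb)
    · obtain ⟨_, _, α, _, rfl⟩ := hb
      exact neg_four_le_boostWeight α
    · rintro _ ⟨_, _, β, _, rfl⟩
      exact boostWeight_le β

theorem bddBelow_boostOrder (g : LinearMap.BilinForm ℝ V) (C : Tensor4 V) :
    BddBelow {b : ℤ | ∃ l, IsNull g l ∧ boostOrder g C l = b} :=
  ⟨-4, by rintro _ ⟨l, _, rfl⟩; exact neg_four_le_boostOrder g C l⟩

theorem bMin_le {C : Tensor4 V} {l : V} (hl : IsNull g l) : bMin g C ≤ boostOrder g C l :=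
  csInf_le (bddBelow_boostOrder g C) ⟨l, hl, rfl⟩

theorem exists_boostOrder_eq_bMin (C : Tensor4 V) (h : ∃ l, IsNull g l) :
    ∃ l, IsNull g l ∧ boostOrder g C l = bMin g C := by
  obtain ⟨l, hl⟩ := h
  exact Int.csInf_mem (s := {b : ℤ | ∃ l, IsNull g l ∧ boostOrder g C l = b}) ⟨_, l, hl, rfl⟩
    (bddBelow_boostOrder g C)

theorem isMultipleWAND_iff {C : Tensor4 V} {l : V} :
    IsMultipleWAND g C l ↔ IsNull g l ∧ boostOrder g C l ≤ 0 := by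
  rw [IsMultipleWAND, alignmentOrder, bMax]
  exact and_congr_right fun _ => by omega

/-! ### Tensors of definite parity under a time reflection -/

/-- The scalar 1 is kept so that PE and PM are both instances of `reflectTensor g u C = ε • C`. -/
theorem isProperlyPE_iff {C : Tensor4 V} {u : V} :
    IsProperlyPE g C u ↔ C ≠ 0 ∧ reflectTensor g u C = (1 : ℝ) • C := by
  have h : C = electricPart g u C ↔ reflectTensor g u C = (1 : ℝ) • C := by
    rw [electricPart]
    constructor
    · intro h
      calc reflectTensor g u C
          = (2 : ℝ) • ((1 / 2 : ℝ) • (C + reflectTensor g u C)) - C := by module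
        _ = (1 : ℝ) • C := by rw [← h]; module
    · intro h
      rw [h]
      module
  rw [IsProperlyPE, ← h, and_comm]
  exact and_congr_left fun h => by rw [← h]

theorem isProperlyPM_iff {C : Tensor4 V} {u : V} :
    IsProperlyPM g C u ↔ C ≠ 0 ∧ reflectTensor g u C = (-1 : ℝ) • C := by
  have h : C = magneticPart g u C ↔ reflectTensor g u C = (-1 : ℝ) • C := by
    rw [magneticPart]
    constructor
    · intro h
      calc reflectTensor g u C
          = C - (2 : ℝ) • ((1 / 2 : ℝ) • (C - reflectTensor g u C)) := by module
        _ = (-1 : ℝ) • C := by rw [← h]; module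
    · intro h
      rw [h]
      module
  rw [IsProperlyPM, ← h, and_comm]
  exact and_congr_left fun h => by rw [← h]

theorem reflectTensor_neg (u : V) (C : Tensor4 V) :
    reflectTensor g (-u) C = reflectTensor g u C := by
  have : timeReflection g (-u) = timeReflection g u := by
    ext x
    simp [timeReflection]
  rw [reflectTensor, this, reflectTensor]

namespace NullFrame

theorem two_mul_mul_eq (hg : IsLorentzian g) (F : NullFrame g) {u : V} {p q : ℝ}
    (hu : IsUnitTimelike g u) (h : u = p • F.l + q • F.n) : 2 * p * q = -1 := by
  have hu' : g u u = -1 := hu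
  have hnl : g F.n F.l = 1 := by rw [hg.symm, F.l_n]
  rw [h] at hu'
  simp only [map_add, map_smul, LinearMap.add_apply, LinearMap.smul_apply, smul_eq_mul, F.l_null,
    F.n_null, F.l_n, hnl] at hu'
  linarith

/-- Since `2pq = -1`, one finds `l ↦ 2q² n` and `n ↦ 2p² l = (2q²)⁻¹ l`, while the spacelike vectors
are fixed; the weight as exponent covers all three cases. -/
theorem timeReflection_vec (hg : IsLorentzian g) (F : NullFrame g) {u : V} {p q : ℝ}
    (hu : IsUnitTimelike g u) (h : u = p • F.l + q • F.n) (a : FrameLabel V) :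
    timeReflection g u (F.vec a) = (2 * q ^ 2) ^ labelWeight a • F.vec (swapLabel a) := by
  have hpq := F.two_mul_mul_eq hg hu h
  have hnl : g F.n F.l = 1 := by rw [hg.symm, F.l_n]
  have hq : q ≠ 0 := by
    rintro rfl
    simp at hpq
  have hp : (2 * q ^ 2)⁻¹ = 2 * p ^ 2 := by
    have : (2 * p * q) ^ 2 = 1 := by rw [hpq]; norm_num
    field_simp
    linarith
  have hT : ∀ x, timeReflection g u x = x + (2 * g u x) • u := fun x => by
    simp [timeReflection, smul_smul]
  rw [hT]
  rcases a with a | a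
  · fin_cases a
    · have h1 : g u F.l = q := by simp [h, F.l_null, hnl]
      have h2 : 2 * q * p = -1 := by linarith
      simp only [Fin.zero_eta, vec_inl_zero, h1, labelWeight, swapLabel, Sum.elim_inl,
        Matrix.cons_val_zero, zpow_one, vec_inl_one]
      rw [h, smul_add, smul_smul, smul_smul, h2]
      module
    · have h1 : g u F.n = p := by simp [h, F.n_null, F.l_n]
      simp only [Fin.mk_one, vec_inl_zero, h1, labelWeight, swapLabel, Sum.elim_inl,
        Matrix.cons_val_one, Matrix.cons_val_fin_one, zpow_neg, zpow_one, vec_inl_one, hp]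
      rw [h, smul_add, smul_smul, smul_smul, hpq]
      module
  · have h1 : g u (F.m a) = 0 := by simp [h, F.l_m, F.n_m]
    simp [h1, labelWeight, swapLabel]

theorem component_reflectTensor (hg : IsLorentzian g) (F : NullFrame g) {u : V} {p q : ℝ}
    (hu : IsUnitTimelike g u) (h : u = p • F.l + q • F.n) (C : Tensor4 V)
    (α : Fin 4 → FrameLabel V) :
    F.component (reflectTensor g u C) α =
      (2 * q ^ 2) ^ boostWeight α * F.component C (fun k => swapLabel (α k)) := by
  have hq : (2 * q ^ 2) ≠ 0 := by
    have hpq := F.two_mul_mul_eq hg hu h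
    have : q ≠ 0 := by
      rintro rfl
      simp at hpq
    positivity
  rw [component, reflectTensor, MultilinearMap.compLinearMap_apply]
  simp only [F.timeReflection_vec hg hu h]
  rw [MultilinearMap.map_smul_univ, component, smul_eq_mul, boostWeight_eq]
  congr 1
  simp [Fin.prod_univ_four, Fin.sum_univ_four, zpow_add₀ hq]

/-- The normalisation `2pq = -1` makes `q` determine `p`. -/
theorem eq_or_eq_neg_of_sq_eq (hg : IsLorentzian g) (F : NullFrame g) {u u' : V} {p q p' q' : ℝ}
    (hu : IsUnitTimelike g u) (h : u = p • F.l + q • F.n)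
    (hu' : IsUnitTimelike g u') (h' : u' = p' • F.l + q' • F.n) (hq : q ^ 2 = q' ^ 2) :
    u' = u ∨ u' = -u := by
  have h1 := F.two_mul_mul_eq hg hu h
  have h2 := F.two_mul_mul_eq hg hu' h'
  have hq0 : q ≠ 0 := by
    rintro rfl
    simp at h1
  rcases sq_eq_sq_iff_eq_or_eq_neg.1 hq with rfl | rfl
  · left
    have : p' = p := mul_right_cancel₀ hq0 (by linarith)
    rw [h, h', this]
  · right
    have : p' = -p := mul_right_cancel₀ hq0 (by linarith)
    rw [h, h', this]
    module

/-- If `C` has definite parity under the reflections of two unit timelike vectors other than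
`±` each other, its components of nonzero boost weight in the plane of the two vectors vanish. -/
theorem component_eq_zero_of_reflectTensor (hg : IsLorentzian g) (F : NullFrame g) {u u' : V}
    {p q p' q' : ℝ} (hu : IsUnitTimelike g u) (h : u = p • F.l + q • F.n)
    (hu' : IsUnitTimelike g u') (h' : u' = p' • F.l + q' • F.n) (hne : u' ≠ u) (hne' : u' ≠ -u)
    {C : Tensor4 V} {ε ε' : ℝ} (hε : ε = 1 ∨ ε = -1) (hε' : ε' = 1 ∨ ε' = -1)
    (hC : reflectTensor g u C = ε • C) (hC' : reflectTensor g u' C = ε' • C)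
    (α : Fin 4 → FrameLabel V) (hα : boostWeight α ≠ 0) : F.component C α = 0 := by
  have hq : q ≠ 0 := by
    have := F.two_mul_mul_eq hg hu h
    rintro rfl
    simp at this
  have hq' : q' ≠ 0 := by
    have := F.two_mul_mul_eq hg hu' h'
    rintro rfl
    simp at this
  have hr : 0 < 2 * q ^ 2 := by positivity
  have hr' : 0 < 2 * q' ^ 2 := by positivity
  -- Exchanged labels are used so that both identities express the same exchanged component through
  -- `F.component C α`.
  have e1 := F.component_reflectTensor hg hu h C fun k => swapLabel (α k)
  have e2 := F.component_reflectTensor hg hu' h' C fun k => swapLabel (α k)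
  simp only [swapLabel_swapLabel, boostWeight_swapLabel, hC, hC'] at e1 e2
  have s : ∀ c : ℝ, ∀ β, F.component (c • C) β = c * F.component C β := fun _ _ => rfl
  rw [s] at e1 e2
  by_contra hx
  have hz := zpow_pos hr (-boostWeight α)
  have hz' := zpow_pos hr' (-boostWeight α)
  have key : (2 * q ^ 2) ^ (-boostWeight α) = (2 * q' ^ 2) ^ (-boostWeight α) := by
    -- Squaring removes the signs `ε` and `ε'`: both sides are the square of the exchanged
    -- component.
    have h1 : ((2 * q ^ 2) ^ (-boostWeight α)) ^ 2 * (F.component C α) ^ 2 =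
        ((2 * q' ^ 2) ^ (-boostWeight α)) ^ 2 * (F.component C α) ^ 2 := by
      rw [← mul_pow, ← mul_pow, ← e1, ← e2]
      rcases hε with rfl | rfl <;> rcases hε' with rfl | rfl <;> ring
    exact (sq_eq_sq₀ hz.le hz'.le).1 (mul_right_cancel₀ (pow_ne_zero 2 hx) h1)
  have hqq := (zpow_left_inj₀ hr.le hr'.le (neg_ne_zero.2 hα)).1 key
  rcases F.eq_or_eq_neg_of_sq_eq hg hu h hu' h' (by linarith) with h | h
  exacts [hne h, hne' h]

/-- If `C` has definite parity, vanishing of the components of positive boost weight implies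
vanishing of those of negative boost weight. -/
theorem component_eq_zero_of_boostWeight_ne_zero (hg : IsLorentzian g) (F : NullFrame g) {u : V}
    {p q : ℝ} (hu : IsUnitTimelike g u) (h : u = p • F.l + q • F.n) {C : Tensor4 V} {ε : ℝ}
    (hε : ε = 1 ∨ ε = -1) (hC : reflectTensor g u C = ε • C)
    (hpos : ∀ α, 0 < boostWeight α → F.component C α = 0)
    (α : Fin 4 → FrameLabel V) (hα : boostWeight α ≠ 0) : F.component C α = 0 := by
  rcases hα.lt_or_gt with hlt | hgt
  · have e := F.component_reflectTensor hg hu h C α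
    rw [hpos (fun k => swapLabel (α k)) (by rw [boostWeight_swapLabel]; omega), mul_zero, hC] at e
    have e' : ε * F.component C α = 0 := e
    rcases hε with rfl | rfl <;> linarith
  · exact hpos α hgt

end NullFrame

/-! ### The action of infinitesimal boosts -/

/-- The skew endomorphism `u ∧ x`. -/
def wedge (g : LinearMap.BilinForm ℝ V) (u x : V) : V →ₗ[ℝ] V :=
  (g u).smulRight x - (g x).smulRight u

theorem wedge_apply (u x y : V) : wedge g u x y = g u y • x - g x y • u := rfl

theorem wedge_zero (u : V) : wedge g u 0 = 0 := by
  ext y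
  simp [wedge_apply]

theorem wedge_add (u x y : V) : wedge g u (x + y) = wedge g u x + wedge g u y := by
  ext z
  simp only [wedge_apply, map_add, LinearMap.add_apply]
  module

theorem wedge_smul (u : V) (c : ℝ) (x : V) : wedge g u (c • x) = c • wedge g u x := by
  ext z
  simp only [wedge_apply, map_smul, LinearMap.smul_apply, smul_eq_mul]
  module

/-- The action of an endomorphism on a tensor by the Leibniz rule. -/
def lieAction (C : Tensor4 V) : (V →ₗ[ℝ] V) →ₗ[ℝ] Tensor4 V :=
  ∑ k, ((MultilinearMap.compLinearMapMultilinear (R := ℝ) (M₁ := fun _ : Fin 4 => V)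
    (M₁' := fun _ : Fin 4 => V) (M₂ := ℝ)).toLinearMap (fun _ => LinearMap.id) k).flip C

theorem lieAction_apply (C : Tensor4 V) (A : V →ₗ[ℝ] V) (y : Fin 4 → V) :
    lieAction C A y = ∑ k, C (Function.update y k (A (y k))) := by
  rw [lieAction, LinearMap.sum_apply, sum_apply]
  refine Finset.sum_congr rfl fun k _ => congrArg C (funext fun i => ?_)
  rcases eq_or_ne i k with rfl | hik
  · simp
  · simp [hik]

namespace NullFrame

/-- Within the null plane `u ∧ x` generates boosts, and a null frame diagonalises it. -/
theorem wedge_vec (hg : IsLorentzian g) (F : NullFrame g) {u x : V} {p q p' q' : ℝ}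
    (h : u = p • F.l + q • F.n) (h' : x = p' • F.l + q' • F.n) (a : FrameLabel V) :
    wedge g u x (F.vec a) = ((q * p' - q' * p) * labelWeight a) • F.vec a := by
  have hnl : g F.n F.l = 1 := by rw [hg.symm, F.l_n]
  rw [wedge_apply]
  rcases a with a | a
  · fin_cases a
    · have h1 : g u F.l = q := by simp [h, F.l_null, hnl]
      have h2 : g x F.l = q' := by simp [h', F.l_null, hnl]
      simp only [Fin.zero_eta, vec_inl_zero, h1, h2, labelWeight, Sum.elim_inl,
        Matrix.cons_val_zero, Int.cast_one]
      rw [h, h']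
      module
    · have h1 : g u F.n = p := by simp [h, F.n_null, F.l_n]
      have h2 : g x F.n = p' := by simp [h', F.n_null, F.l_n]
      simp only [Fin.mk_one, vec_inl_one, h1, h2, labelWeight, Sum.elim_inl,
        Matrix.cons_val_one, Matrix.cons_val_fin_one, Int.cast_neg, Int.cast_one]
      rw [h, h']
      module
  · have h1 : g u (F.m a) = 0 := by simp [h, F.l_m, F.n_m]
    have h2 : g x (F.m a) = 0 := by simp [h', F.l_m, F.n_m]
    simp [h1, h2, labelWeight]

theorem component_lieAction_wedge (hg : IsLorentzian g) (F : NullFrame g) {u x : V}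
    {p q p' q' : ℝ} (h : u = p • F.l + q • F.n) (h' : x = p' • F.l + q' • F.n) (C : Tensor4 V)
    (α : Fin 4 → FrameLabel V) :
    F.component (lieAction C (wedge g u x)) α =
      (q * p' - q' * p) * boostWeight α * F.component C α := by
  rw [component, lieAction_apply]
  simp only [F.wedge_vec hg h h', MultilinearMap.map_update_smul, Function.update_eq_self,
    smul_eq_mul]
  rw [← Finset.sum_mul, ← Finset.mul_sum, boostWeight_eq, Int.cast_sum]
  rfl

end NullFrame

/-! ### Multiple WANDs -/

/-- By linearity in `x` it suffices to treat one multiple WAND. In a frame adapted to it and `u`,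
parity leaves only components of weight 0, which boosts annihilate. -/
theorem lieAction_wedge_eq_zero_of_mem [FiniteDimensional ℝ V] (hg : IsLorentzian g)
    (hn : 2 ≤ finrank ℝ V) {u : V} (hu : IsUnitTimelike g u) {C : Tensor4 V} {ε : ℝ}
    (hε : ε = 1 ∨ ε = -1) (hC : reflectTensor g u C = ε • C) {x : V}
    (hx : x ∈ multipleWANDSpan g C) : lieAction C (wedge g u x) = 0 := by
  induction hx using Submodule.span_induction with
  | mem l hl =>
    obtain ⟨hl0, hlb⟩ := isMultipleWAND_iff.1 hl
    obtain ⟨F, rfl, p, q, hpq⟩ := hg.exists_nullFrame hu hl0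
    refine F.ext_component hg hn fun α => ?_
    rw [F.component_lieAction_wedge hg hpq (p' := 1) (q' := 0) (by simp)]
    change _ = 0
    rcases eq_or_ne (boostWeight α) 0 with h0 | h0
    · simp [h0]
    · rw [F.component_eq_zero_of_boostWeight_ne_zero hg hu hpq hε hC
        (fun β => F.component_eq_zero_of_boostOrder_le hlb β) α h0, mul_zero]
  | zero => rw [wedge_zero, map_zero]
  | add x y _ _ hx hy => rw [wedge_add, map_add, hx, hy, add_zero]
  | smul c x _ hx => rw [wedge_smul, map_smul, hx, smul_zero]

theorem reflectTensor_of_mem_multipleWANDSpan [FiniteDimensional ℝ V] (hg : IsLorentzian g)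
    (hn : 2 ≤ finrank ℝ V) {u u' : V} (hu : IsUnitTimelike g u) (hu' : IsUnitTimelike g u')
    {C : Tensor4 V} {ε : ℝ} (hε : ε = 1 ∨ ε = -1) (hC : reflectTensor g u C = ε • C)
    (hx : u' ∈ multipleWANDSpan g C) : reflectTensor g u' C = ε • C := by
  by_cases h1 : u' = u
  · rwa [h1]
  by_cases h2 : u' = -u
  · rwa [h2, reflectTensor_neg]
  obtain ⟨F, ⟨p, q, h⟩, p', q', h'⟩ := hg.exists_nullFrame_pair hu hu' h1 h2
  have hpq := F.two_mul_mul_eq hg hu h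
  have hpq' := F.two_mul_mul_eq hg hu' h'
  have hl : q * p' - q' * p ≠ 0 := by
    intro h0
    -- Multiplying `q p' = q' p` by `2 q q'` and inserting `2pq = 2p'q' = -1`.
    have : q ^ 2 = q' ^ 2 := by linear_combination (-2 * q * q') * h0 - q' ^ 2 * hpq + q ^ 2 * hpq'
    rcases F.eq_or_eq_neg_of_sq_eq hg hu h hu' h' this with h | h
    exacts [h1 h, h2 h]
  have hz : ∀ α, boostWeight α ≠ 0 → F.component C α = 0 := by
    intro α hα
    have e := F.component_lieAction_wedge hg h h' C α
    rw [lieAction_wedge_eq_zero_of_mem hg hn hu hε hC hx] at e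
    have e' : 0 = (q * p' - q' * p) * boostWeight α * F.component C α := e
    simpa [hl, hα] using e'.symm
  rw [← hC]
  refine F.ext_component hg hn fun α => ?_
  -- The two reflections differ only in the factors `(2q²)^b` and `(2q'²)^b`, which are both 1 on
  -- the surviving weight 0.
  rw [F.component_reflectTensor hg hu h, F.component_reflectTensor hg hu' h']
  by_cases hα : boostWeight α = 0
  · simp [hα]
  · rw [hz _ (by rw [boostWeight_swapLabel]; omega), mul_zero, mul_zero]

/-- Parity makes the reflected null direction a multiple WAND too, and `u` is a combination of the
pair. -/
theorem mem_multipleWANDSpan_of_reflectTensor [FiniteDimensional ℝ V] (hg : IsLorentzian g)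
    (hn : 2 ≤ finrank ℝ V) {u : V} (hu : IsUnitTimelike g u)
    {C : Tensor4 V} {ε : ℝ} (hε : ε = 1 ∨ ε = -1) (hC : reflectTensor g u C = ε • C)
    (hw : ∃ l, IsMultipleWAND g C l) : u ∈ multipleWANDSpan g C := by
  obtain ⟨l, hl⟩ := hw
  obtain ⟨hl0, hlb⟩ := isMultipleWAND_iff.1 hl
  obtain ⟨F, rfl, p, q, hpq⟩ := hg.exists_nullFrame hu hl0
  have hz := F.component_eq_zero_of_boostWeight_ne_zero hg hu hpq hε hC
    fun β => F.component_eq_zero_of_boostOrder_le hlb β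
  have hnW : IsMultipleWAND g C F.n := by
    refine isMultipleWAND_iff.2 ⟨(F.swap hg).isNull_l,
      (F.swap hg).boostOrder_l_nonpos hg hn fun α hα => ?_⟩
    have := hz (fun k => swapLabel (α k)) (by rw [boostWeight_swapLabel]; omega)
    simpa only [NullFrame.component, NullFrame.swap_vec] using this
  rw [hpq]
  exact add_mem (Submodule.smul_mem _ _ (Submodule.subset_span hl))
    (Submodule.smul_mem _ _ (Submodule.subset_span hnW))

theorem isLorentzian_restrict_and_forall [FiniteDimensional ℝ V] (hg : IsLorentzian g)
    (hn : 2 ≤ finrank ℝ V) {u : V} (hu : IsUnitTimelike g u)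
    {C : Tensor4 V} {ε : ℝ} (hε : ε = 1 ∨ ε = -1) (hC : reflectTensor g u C = ε • C)
    (hD : IsTypeD g C) :
    IsLorentzian (g.restrict (multipleWANDSpan g C)) ∧
      ∀ u', IsUnitTimelike g u' → (reflectTensor g u' C = ε • C ↔ u' ∈ multipleWANDSpan g C) := by
  have hw : ∃ l, IsMultipleWAND g C l := by
    -- Primary type 2 says `bMin = 0`, and the minimum is attained, so a multiple WAND exists.
    obtain ⟨l, hl, hlb⟩ := exists_boostOrder_eq_bMin C (hg.exists_isNull hn hu)
    have h2 := hD.2.1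
    rw [primaryType, bMax] at h2
    exact ⟨l, isMultipleWAND_iff.2 ⟨hl, by omega⟩⟩
  exact ⟨hg.restrict hu (mem_multipleWANDSpan_of_reflectTensor hg hn hu hε hC hw),
    fun u' hu' => ⟨fun h => mem_multipleWANDSpan_of_reflectTensor hg hn hu' hε h hw,
      fun h => reflectTensor_of_mem_multipleWANDSpan hg hn hu hu' hε hC h⟩⟩

/-! ### Uniqueness of parity and of the unit timelike vector -/

theorem eq_zero_of_reflectTensor_one_neg_one [FiniteDimensional ℝ V] (hg : IsLorentzian g)
    (hn : 2 ≤ finrank ℝ V) {u u' : V} (hu : IsUnitTimelike g u) (hu' : IsUnitTimelike g u')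
    {C : Tensor4 V} (hC : reflectTensor g u C = (1 : ℝ) • C)
    (hC' : reflectTensor g u' C = (-1 : ℝ) • C) : C = 0 := by
  have key : reflectTensor g u' C = reflectTensor g u C → C = 0 := by
    intro h
    rw [hC, hC', one_smul] at h
    have : (2 : ℝ) • C = C - (-1 : ℝ) • C := by module
    rw [h, sub_self] at this
    exact (smul_eq_zero.1 this).resolve_left two_ne_zero
  by_cases h1 : u' = u
  · exact key (by rw [h1])
  by_cases h2 : u' = -u
  · exact key (by rw [h2, reflectTensor_neg])
  obtain ⟨F, ⟨p, q, h⟩, p', q', h'⟩ := hg.exists_nullFrame_pair hu hu' h1 h2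
  refine key (F.ext_component hg hn fun α => ?_)
  rw [F.component_reflectTensor hg hu h, F.component_reflectTensor hg hu' h']
  by_cases hα : boostWeight α = 0
  · simp [hα]
  · rw [F.component_eq_zero_of_reflectTensor hg hu h hu' h' h1 h2 (Or.inl rfl) (Or.inr rfl) hC hC'
      _ (by rw [boostWeight_swapLabel]; omega), mul_zero, mul_zero]

theorem reflectTensor_iff_eq_or_eq_neg [FiniteDimensional ℝ V] (hg : IsLorentzian g)
    (hn : 2 ≤ finrank ℝ V) {u u' : V} (hu : IsUnitTimelike g u) (hu' : IsUnitTimelike g u')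
    {C : Tensor4 V} {ε : ℝ} (hε : ε = 1 ∨ ε = -1) (hC : reflectTensor g u C = ε • C)
    (hT : IsTypeIi g C ∨ IsTypeG g C) : reflectTensor g u' C = ε • C ↔ u' = u ∨ u' = -u := by
  constructor
  · intro hC'
    by_contra! hne
    obtain ⟨F, ⟨p, q, h⟩, p', q', h'⟩ := hg.exists_nullFrame_pair hu hu' hne.1 hne.2
    -- A second vector would force `bMin ≤ 0`, whereas `bMin` is 1 for type I_i and 2 for type G.
    have h1 := F.boostOrder_l_nonpos hg hn fun α hα =>
      F.component_eq_zero_of_reflectTensor hg hu h hu' h' hne.1 hne.2 hε hε hC hC' α hα.ne'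
    have h2 := bMin_le (C := C) F.isNull_l
    rcases hT with ⟨_, hT, _⟩ | ⟨_, hT⟩ <;> rw [primaryType, bMax] at hT <;> omega
  · rintro (rfl | rfl)
    · exact hC
    · rwa [reflectTensor_neg]

end NullAlign

end

theorem mainTheorem3 {V : Type*} [AddCommGroup V] [Module ℝ V] [FiniteDimensional ℝ V]
    (hn : 4 ≤ Module.finrank ℝ V)
    (g : LinearMap.BilinForm ℝ V) (hg : NullAlign.IsLorentzian g)
    (C : NullAlign.Tensor4 V) (hC : NullAlign.IsWeylTensor g C) :
    (¬ ((∃ u, NullAlign.IsUnitTimelike g u ∧ NullAlign.IsProperlyPE g C u) ∧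
        (∃ u', NullAlign.IsUnitTimelike g u' ∧ NullAlign.IsProperlyPM g C u'))) ∧
    (NullAlign.IsTypeD g C →
      ((∃ u, NullAlign.IsUnitTimelike g u ∧ NullAlign.IsProperlyPE g C u) →
        NullAlign.IsLorentzian (g.restrict (NullAlign.multipleWANDSpan g C)) ∧
        ∀ u, NullAlign.IsUnitTimelike g u →
          (NullAlign.IsProperlyPE g C u ↔ u ∈ NullAlign.multipleWANDSpan g C)) ∧
      ((∃ u, NullAlign.IsUnitTimelike g u ∧ NullAlign.IsProperlyPM g C u) →
        NullAlign.IsLorentzian (g.restrict (NullAlign.multipleWANDSpan g C)) ∧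
        ∀ u, NullAlign.IsUnitTimelike g u →
          (NullAlign.IsProperlyPM g C u ↔ u ∈ NullAlign.multipleWANDSpan g C))) ∧
    (NullAlign.IsTypeIi g C ∨ NullAlign.IsTypeG g C →
      (∀ u u', NullAlign.IsUnitTimelike g u → NullAlign.IsUnitTimelike g u' →
        NullAlign.IsProperlyPE g C u →
          (NullAlign.IsProperlyPE g C u' ↔ u' = u ∨ u' = -u)) ∧
      (∀ u u', NullAlign.IsUnitTimelike g u → NullAlign.IsUnitTimelike g u' →
        NullAlign.IsProperlyPM g C u →
          (NullAlign.IsProperlyPM g C u' ↔ u' = u ∨ u' = -u))) := by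
  have hn' : 2 ≤ Module.finrank ℝ V := by omega
  simp only [NullAlign.isProperlyPE_iff, NullAlign.isProperlyPM_iff]
  refine ⟨?_, fun hD => ⟨?_, ?_⟩, fun hT => ⟨?_, ?_⟩⟩
  · rintro ⟨⟨u, hu, h0, h⟩, u', hu', -, h'⟩
    exact h0 (NullAlign.eq_zero_of_reflectTensor_one_neg_one hg hn' hu hu' h h')
  · rintro ⟨u, hu, h0, h⟩
    simpa only [ne_eq, h0, not_false_eq_true, true_and] using
      NullAlign.isLorentzian_restrict_and_forall hg hn' hu (Or.inl rfl) h hD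
  · rintro ⟨u, hu, h0, h⟩
    simpa only [ne_eq, h0, not_false_eq_true, true_and] using
      NullAlign.isLorentzian_restrict_and_forall hg hn' hu (Or.inr rfl) h hD
  · rintro u u' hu hu' ⟨h0, h⟩
    simpa only [ne_eq, h0, not_false_eq_true, true_and] using
      NullAlign.reflectTensor_iff_eq_or_eq_neg hg hn' hu hu' (Or.inl rfl) h hT
  · rintro u u' hu hu' ⟨h0, h⟩
    simpa only [ne_eq, h0, not_false_eq_true, true_and] using
      NullAlign.reflectTensor_iff_eq_or_eq_neg hg hn' hu hu' (Or.inr rfl) h hT
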